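/- Let $N$ and $X$ be Hermitian manifolds, i.e. complex manifolds with smooth Riemannian metrics invariant under the complex structures, where $N$ is non-empty and $\dim_{\mathbb C} N\ge 1$. A smooth map $\phi$ from an open subset $U$ of $N$ to $X$ is called holomorphic if $d\phi\circ J=J\circ d\phi$, antiholomorphic if $d\phi\circ J=-J\circ d\phi$, and $\pm$holomorphic if it is one or the other. A smooth map $\phi$ from an open subset $U$ of $N$ to a Riemannian manifold is called pluriharmonic if, for all points $p\in U$, all $Z\in T^{(1,0)}_pN$ and all smooth sections $W$ of $T^{(1,0)}N$ near $p$, $${}^{\phi}\nabla_{\overline Z}\bigl(d'\phi(W)\bigr)-d'\phi\bigl(\overline\partial_{\overline Z}W\bigr)=0 ,$$ where ${}^{\phi}\nabla$ is the (complexified) pull-back by $\phi$ of the Levi-Civita connection of the target and $d'\phi$ is the restriction of the complexified differential of $\phi$ to $T^{(1,0)}N$. Then the following are equivalent: 1. every $\pm$holomorphic map from an open subset of $N$ to $X$ is pluriharmonic; 2. $X$ is Kähler, i.e. its fundamental 2-form $\omega(u,v)=g(Ju,v)$ is closed. Moreover, every $\pm$holomorphic function $f:U\to\mathbb C$ on an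 open subset $U$ of $N$ is pluriharmonic, where $\mathbb C$ carries its standard flat metric. -/

import Mathlib

open scoped Manifold ContDiff Topology

noncomputable section

/-! ### Complex manifolds as real manifolds

A complex manifold is a charted space over a finite-dimensional complex normed space `E` with
`IsManifold 𝓘(ℂ, E) ω M`; its underlying real manifold has the same charts and the model
`𝓘(ℝ, E)`. -/

/-- The real smooth structure underlying a complex manifold. -/
instance isManifold_real_of_complex (E : Type*) [NormedAddCommGroup E] [NormedSpace ℂ E]
    (M : Type*) [TopologicalSpace M] [ChartedSpace E M] [IsManifold 𝓘(ℂ, E) ω M] :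
    IsManifold 𝓘(ℝ, E) ∞ M := by
  refine isManifold_of_contDiffOn _ _ _ fun e e' he he' => ?_
  have h := ((contDiffGroupoid ω 𝓘(ℂ, E)).compatible he he')
  rw [contDiffGroupoid, mem_groupoid_of_pregroupoid] at h
  exact (ContDiffOn.restrict_scalars ℝ h.1).of_le le_top

/-- The complex structure `J` on the (real) tangent spaces of a complex manifold. The tangent space
at `x` is identified with `E` by the holomorphic chart at `x`, so that `J` is multiplication by `i`.
-/
def complexStructure {E : Type*} [NormedAddCommGroup E] [NormedSpace ℂ E]
    {M : Type*} [TopologicalSpace M] [ChartedSpace E M] (x : M) :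
    TangentSpace 𝓘(ℝ, E) x →L[ℝ] TangentSpace 𝓘(ℝ, E) x :=
  (Complex.I • ContinuousLinearMap.id ℝ E : E →L[ℝ] E)

/-! ### Riemannian metrics and the Levi-Civita connection in charts -/

/-- A smooth Riemannian metric on a real manifold `X` modelled on `F`. -/
abbrev SmoothMetric (F : Type*) [NormedAddCommGroup F] [NormedSpace ℝ F]
    (X : Type*) [TopologicalSpace X] [ChartedSpace F X] [IsManifold 𝓘(ℝ, F) ∞ X] :=
  Bundle.ContMDiffRiemannianMetric 𝓘(ℝ, F) ∞ F (fun x : X => TangentSpace 𝓘(ℝ, F) x)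

/-- The standard flat metric on `ℂ`, the real part of `(v, w) ↦ conj v * w`. -/
def flatMetricComplex : SmoothMetric ℂ ℂ :=
  { riemannianMetricVectorSpace ℂ with
    contMDiff := (riemannianMetricVectorSpace ℂ).contMDiff.of_le le_top }

section Riemannian

variable {F : Type*} [NormedAddCommGroup F] [NormedSpace ℝ F]
  {X : Type*} [TopologicalSpace X] [ChartedSpace F X] [IsManifold 𝓘(ℝ, F) ∞ X]

/-- The metric `g` read in the chart at `x`: its pullback by the inverse of that chart. It is
meaningful at the points `y` of the target of the chart. -/
def metricInChart (g : SmoothMetric F X) (x : X) (y : F) : F →L[ℝ] F →L[ℝ] ℝ :=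
  let G : F →L[ℝ] F →L[ℝ] ℝ := g.inner ((extChartAt 𝓘(ℝ, F) x).symm y)
  let A : F →L[ℝ] F := mfderiv 𝓘(ℝ, F) 𝓘(ℝ, F) (extChartAt 𝓘(ℝ, F) x).symm y
  G.bilinearComp A A

/-- The linear form `w ↦ D_u g (v, w) + D_v g (u, w) - D_w g (u, v)` at the point `y` of the chart
at `x`. -/
def koszulForm (g : SmoothMetric F X) (x : X) (y u v : F) : F →L[ℝ] ℝ :=
  let D : F →L[ℝ] F →L[ℝ] F →L[ℝ] ℝ := fderiv ℝ (metricInChart g x) y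
  D u v + D v u - (D.flip u).flip v

/-- The Christoffel symbols of the Levi-Civita connection of `g` in the chart at `x`, as the bilinear
map `(u, v) ↦ Γ_y(u, v) = u^J v^L Γ^A_{JL}(y) ∂_A`: the vector with
`g_y(Γ_y(u, v), w) = (D_u g (v, w) + D_v g (u, w) - D_w g (u, v)) / 2` for all `w`. -/
def christoffel (g : SmoothMetric F X) (x : X) (y u v : F) : F :=
  (1 / 2 : ℝ) • (metricInChart g x y).inverse (koszulForm g x y u v)

end Riemannian

/-! ### Complexified vector spaces -/

/-- The complexification of a real vector space `V`: the pair `(a, b)` stands for `a + i b`. -/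
abbrev Cplx (V : Type*) := V × V

namespace Cplx

variable {V W G : Type*} [NormedAddCommGroup V] [NormedSpace ℝ V]
  [NormedAddCommGroup W] [NormedSpace ℝ W] [NormedAddCommGroup G] [NormedSpace ℝ G]

/-- Complex conjugation `a + i b ↦ a - i b`. -/
def conj (z : Cplx V) : Cplx V := (z.1, -z.2)

/-- Multiplication by the scalar `i` of the complexification, `a + i b ↦ -b + i a`. -/
def mulI (z : Cplx V) : Cplx V := (-z.2, z.1)

/-- The complex linear extension of a real linear map. -/
def mapLinear (L : V →L[ℝ] W) (z : Cplx V) : Cplx W := (L z.1, L z.2)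

/-- The complex bilinear extension of a real bilinear map. -/
def mapBilinear (B : V → V → W) (z w : Cplx V) : Cplx W :=
  (B z.1 w.1 - B z.2 w.2, B z.1 w.2 + B z.2 w.1)

/-- The derivative at `y` of the complexified vector valued function `S` along the complexified
vector `Z`. -/
def deriv (S : V → Cplx W) (y : V) (Z : Cplx V) : Cplx W :=
  fderiv ℝ S y Z.1 + mulI (fderiv ℝ S y Z.2)

/-- For a complex vector space `E` whose complex structure is `J = I • ·`: a vector `Z` of the
complexification is of type (1,0) if `J Z = i Z`. -/
def IsType10 {E : Type*} [NormedAddCommGroup E] [NormedSpace ℂ E] (Z : Cplx E) : Prop :=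
  ((Complex.I • Z.1, Complex.I • Z.2) : Cplx E) = mulI Z

end Cplx

/-! ### Pluriharmonic maps -/

section Pluriharmonic

variable {F : Type*} [NormedAddCommGroup F] [NormedSpace ℝ F]
  {X : Type*} [TopologicalSpace X] [ChartedSpace F X] [IsManifold 𝓘(ℝ, F) ∞ X]

/-- The pull-back connection on `φ⁻¹ T^ℂ X` in charts. Here `f` is the coordinate expression of `φ`
with values in the chart at `x`, and `S` that of a section of `φ⁻¹ T^ℂ X`; the value is
`(^φ∇_Z S)(y) = D_Z S (y) + Γ_{f(y)}(df(Z), S(y))`. -/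
def pullbackCovDeriv {E : Type*} [NormedAddCommGroup E] [NormedSpace ℂ E]
    (g : SmoothMetric F X) (x : X) (f : E → F) (y : E) (Z : Cplx E) (S : E → Cplx F) : Cplx F :=
  Cplx.deriv S y Z +
    Cplx.mapBilinear (christoffel g x (f y)) (Cplx.mapLinear (fderiv ℝ f y) Z) (S y)

/-- The pluriharmonic equation at `p` for a map `φ` into a Riemannian manifold that is smooth
near `p`: for all `Z ∈ T_p^{(1,0)} N` and all smooth local sections `W` of `T^{(1,0)} N`,
`^φ∇_{Z̄} (d'φ(W)) - d'φ(∂̄_{Z̄} W) = 0`, where `d'φ` is the restriction of the complexified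
differential to `T^{(1,0)} N`. It is written in the chart at `p`, which is holomorphic, so that
`∂̄_{Z̄}` differentiates the components of `W`, and in the chart at `φ p`. -/
def IsPluriharmonicAt (E : Type*) [NormedAddCommGroup E] [NormedSpace ℂ E]
    {N : Type*} [TopologicalSpace N] [ChartedSpace E N]
    (g : SmoothMetric F X) (φ : N → X) (p : N) : Prop :=
  let f : E → F := writtenInExtChartAt 𝓘(ℝ, E) 𝓘(ℝ, F) p φ
  let y : E := extChartAt 𝓘(ℝ, E) p p
  ∀ (Z : Cplx E) (W : E → Cplx E), Z.IsType10 → ContDiffAt ℝ ∞ W y →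
    (∀ᶠ y' in 𝓝 y, (W y').IsType10) →
    pullbackCovDeriv g (φ p) f y Z.conj (fun y' => Cplx.mapLinear (fderiv ℝ f y') (W y')) -
      Cplx.mapLinear (fderiv ℝ f y) (Cplx.deriv W y Z.conj) = 0

/-- `φ` is a pluriharmonic map from the open subset `U` of the complex manifold `N` to the
Riemannian manifold `(X, g)`. Only the values of `φ` on `U` matter. -/
def IsPluriharmonicOn (E : Type*) [NormedAddCommGroup E] [NormedSpace ℂ E]
    {N : Type*} [TopologicalSpace N] [ChartedSpace E N]
    (g : SmoothMetric F X) (φ : N → X) (U : Set N) : Prop :=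
  ContMDiffOn 𝓘(ℝ, E) 𝓘(ℝ, F) ∞ φ U ∧ ∀ p ∈ U, IsPluriharmonicAt E g φ p

end Pluriharmonic

/-! ### Holomorphic and antiholomorphic maps -/

section Holomorphic

variable (E : Type*) [NormedAddCommGroup E] [NormedSpace ℂ E]
  {N : Type*} [TopologicalSpace N] [ChartedSpace E N]
  (F : Type*) [NormedAddCommGroup F] [NormedSpace ℂ F]
  {X : Type*} [TopologicalSpace X] [ChartedSpace F X]

/-- `φ` is holomorphic on the open set `U`: smooth with `dφ ∘ J = J ∘ dφ`. -/
def IsHolomorphicMapOn (φ : N → X) (U : Set N) : Prop :=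
  ContMDiffOn 𝓘(ℝ, E) 𝓘(ℝ, F) ∞ φ U ∧
    ∀ p ∈ U, ∀ v : TangentSpace 𝓘(ℝ, E) p,
      mfderiv 𝓘(ℝ, E) 𝓘(ℝ, F) φ p (complexStructure p v) =
        complexStructure (φ p) (mfderiv 𝓘(ℝ, E) 𝓘(ℝ, F) φ p v)

/-- `φ` is antiholomorphic on the open set `U`: smooth with `dφ ∘ J = -J ∘ dφ`. -/
def IsAntiholomorphicMapOn (φ : N → X) (U : Set N) : Prop :=
  ContMDiffOn 𝓘(ℝ, E) 𝓘(ℝ, F) ∞ φ U ∧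
    ∀ p ∈ U, ∀ v : TangentSpace 𝓘(ℝ, E) p,
      mfderiv 𝓘(ℝ, E) 𝓘(ℝ, F) φ p (complexStructure p v) =
        -complexStructure (φ p) (mfderiv 𝓘(ℝ, E) 𝓘(ℝ, F) φ p v)

/-- `φ` is ±holomorphic on the open set `U`: holomorphic or antiholomorphic. -/
def IsPMHolomorphicOn (φ : N → X) (U : Set N) : Prop :=
  IsHolomorphicMapOn E F φ U ∨ IsAntiholomorphicMapOn E F φ U

end Holomorphic

/-! ### Hermitian and Kähler metrics -/

section Hermitian

variable {F : Type*} [NormedAddCommGroup F] [NormedSpace ℂ F]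
  {X : Type*} [TopologicalSpace X] [ChartedSpace F X] [IsManifold 𝓘(ℂ, F) ω X]

/-- A Hermitian metric on a complex manifold: a smooth Riemannian metric invariant under `J`. -/
structure HermitianMetric (F : Type*) [NormedAddCommGroup F] [NormedSpace ℂ F]
    (X : Type*) [TopologicalSpace X] [ChartedSpace F X] [IsManifold 𝓘(ℂ, F) ω X] where
  /-- The underlying Riemannian metric. -/
  toSmoothMetric : SmoothMetric F X
  /-- Invariance under the complex structure. -/
  invariant : ∀ (x : X) (u v : TangentSpace 𝓘(ℝ, F) x),
    toSmoothMetric.inner x (complexStructure x u) (complexStructure x v) =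
      toSmoothMetric.inner x u v

theorem complexStructure_complexStructure {F : Type*} [NormedAddCommGroup F] [NormedSpace ℂ F]
    {X : Type*} [TopologicalSpace X] [ChartedSpace F X] (x : X) (v : TangentSpace 𝓘(ℝ, F) x) :
    complexStructure x (complexStructure x v) = -v := by
  let w : F := v
  change Complex.I • (Complex.I • w) = -w
  rw [smul_smul, Complex.I_mul_I, neg_one_smul]

theorem HermitianMetric.inner_complexStructure_self (g : HermitianMetric F X) (x : X)
    (v : TangentSpace 𝓘(ℝ, F) x) : g.toSmoothMetric.inner x (complexStructure x v) v = 0 := by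
  have h := g.invariant x (complexStructure x v) v
  rw [complexStructure_complexStructure, map_neg, neg_apply,
    g.toSmoothMetric.symm] at h
  linarith

/-- The fundamental 2-form `ω(u, v) = g(J u, v)`, up to a constant factor on which its closedness
does not depend. -/
def HermitianMetric.fundamentalForm (g : HermitianMetric F X) (x : X) :
    TangentSpace 𝓘(ℝ, F) x [⋀^Fin 2]→L[ℝ] ℝ where
  toFun v := g.toSmoothMetric.inner x (complexStructure x (v 0)) (v 1)
  map_update_add' v i a b := by
    fin_cases i <;> simp [Function.update]
  map_update_smul' v i c a := by
    fin_cases i <;> simp [Function.update]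
  map_eq_zero_of_eq' v i j hij hne := by
    have h : v 0 = v 1 := by
      fin_cases i <;> fin_cases j <;> simp_all
    rw [h]
    exact g.inner_complexStructure_self x (v 1)
  cont := by
    let G : F →L[ℝ] F →L[ℝ] ℝ := g.toSmoothMetric.inner x
    let J : F →L[ℝ] F := complexStructure (E := F) x
    change Continuous fun v : Fin 2 → F => G (J (v 0)) (v 1)
    fun_prop

/-- The fundamental form read in the chart at `x`: its pullback by the inverse of that chart. -/
def HermitianMetric.fundamentalFormInChart (g : HermitianMetric F X) (x : X) (y : F) :
    F [⋀^Fin 2]→L[ℝ] ℝ :=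
  let A : F →L[ℝ] TangentSpace 𝓘(ℝ, F) ((extChartAt 𝓘(ℝ, F) x).symm y) :=
    mfderiv 𝓘(ℝ, F) 𝓘(ℝ, F) (extChartAt 𝓘(ℝ, F) x).symm y
  (g.fundamentalForm ((extChartAt 𝓘(ℝ, F) x).symm y)).compContinuousLinearMap A

/-- A Hermitian metric on a complex manifold is Kähler if its fundamental form is closed: `dω = 0`
at every point `x`, the exterior derivative being computed in the chart at `x`. (The complex
structure of a complex manifold is integrable.) -/
def HermitianMetric.IsKahler (g : HermitianMetric F X) : Prop :=
  ∀ x : X, extDeriv (g.fundamentalFormInChart x) (extChartAt 𝓘(ℝ, F) x x) = 0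

end Hermitian

end

/-! ### Real derivatives of complex differentiable maps -/

section ComplexDerivative

variable {E : Type*} [NormedAddCommGroup E] [NormedSpace ℂ E]
  {F : Type*} [NormedAddCommGroup F] [NormedSpace ℂ F]
  {N : Type*} [TopologicalSpace N] [ChartedSpace E N]
  {X : Type*} [TopologicalSpace X] [ChartedSpace F X]

/-! Both conditions are equivalent to the pointwise vanishing of the type (1,1) part of the
Christoffel symbols of the target: Γ(u, v) + Γ(Ju, Jv) = 0. In holomorphic charts the differential
of a ±holomorphic map f commutes with J up to a sign, so its Hessian is complex linear or antilinear
in each slot. The mixed terms D²f(Z̄, W) then cancel (`deriv_mapLinear_fderiv`), and the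
pluriharmonic equation reduces to Γ(df Z̄, df W) = 0. This follows from the (1,1) condition, and
trivially in the flat case, where Γ = 0. Conversely, holomorphic maps with prescribed df(a) = u
(`exists_isHolomorphicMapOn`) give Γ(u, u) + Γ(Ju, Ju) = 0 for every u; polarisation recovers the
(1,1) condition. That condition amounts to dω = 0 by linear algebra on the first derivative D of the
metric in a chart: the Koszul formula writes Γ through D, ω(u, v) = g(Ju, v) writes dω through D,
and J-invariance of the metric links the two (`closed_iff_koszul_of_hermitian`,
`HermitianMetric.isKahler_iff_christoffel`). -/

theorem MDifferentiableAt.real_of_complex {φ : N → X} {p : N}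
    (h : MDifferentiableAt 𝓘(ℂ, E) 𝓘(ℂ, F) φ p) : MDifferentiableAt 𝓘(ℝ, E) 𝓘(ℝ, F) φ p := by
  rw [mdifferentiableAt_iff] at h ⊢
  exact ⟨h.1, DifferentiableWithinAt.restrictScalars ℝ h.2⟩

/-- The real derivative of a complex differentiable map commutes with the complex structures. -/
theorem MDifferentiableAt.mfderiv_complexStructure {φ : N → X} {p : N}
    (h : MDifferentiableAt 𝓘(ℂ, E) 𝓘(ℂ, F) φ p) (v : TangentSpace 𝓘(ℝ, E) p) :
    mfderiv 𝓘(ℝ, E) 𝓘(ℝ, F) φ p (complexStructure p v) =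
      complexStructure (φ p) (mfderiv 𝓘(ℝ, E) 𝓘(ℝ, F) φ p v) := by
  have h2 := h.differentiableWithinAt_writtenInExtChartAt
  rw [h.real_of_complex.mfderiv]
  simp only [ModelWithCorners.range_eq_univ, differentiableWithinAt_univ, fderivWithin_univ] at h2 ⊢
  have h3 : fderiv ℝ (writtenInExtChartAt 𝓘(ℝ, E) 𝓘(ℝ, F) p φ) (extChartAt 𝓘(ℝ, E) p p) = _ :=
    h2.fderiv_restrictScalars ℝ
  rw [h3]
  exact ContinuousLinearMap.map_smul
    (fderiv ℂ (writtenInExtChartAt 𝓘(ℂ, E) 𝓘(ℂ, F) p φ) (extChartAt 𝓘(ℂ, E) p p)) Complex.I _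

variable [IsManifold 𝓘(ℂ, F) ω X]

theorem mdifferentiableAt_extChartAt_symm {𝕜 : Type*} [NontriviallyNormedField 𝕜]
    {G : Type*} [NormedAddCommGroup G] [NormedSpace 𝕜 G]
    {M : Type*} [TopologicalSpace M] [ChartedSpace G M] [IsManifold 𝓘(𝕜, G) 1 M]
    {x : M} {y : G} (hy : y ∈ (extChartAt 𝓘(𝕜, G) x).target) :
    MDifferentiableAt 𝓘(𝕜, G) 𝓘(𝕜, G) (extChartAt 𝓘(𝕜, G) x).symm y := by
  have h := mdifferentiableWithinAt_extChartAt_symm hy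
  rwa [ModelWithCorners.range_eq_univ, mdifferentiableWithinAt_univ] at h

theorem mfderiv_extChartAt_symm_complexStructure {x : X} {y : F}
    (hy : y ∈ (extChartAt 𝓘(ℝ, F) x).target) (v : F) :
    mfderiv 𝓘(ℝ, F) 𝓘(ℝ, F) (extChartAt 𝓘(ℝ, F) x).symm y (Complex.I • v : F) =
      complexStructure ((extChartAt 𝓘(ℝ, F) x).symm y)
        (mfderiv 𝓘(ℝ, F) 𝓘(ℝ, F) (extChartAt 𝓘(ℝ, F) x).symm y v) :=
  (mdifferentiableAt_extChartAt_symm (𝕜 := ℂ) (x := x) hy).mfderiv_complexStructure v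

theorem mfderiv_extChartAt_complexStructure {x x' : X}
    (hx' : x' ∈ (chartAt F x).source) (v : TangentSpace 𝓘(ℝ, F) x') :
    mfderiv 𝓘(ℝ, F) 𝓘(ℝ, F) (extChartAt 𝓘(ℝ, F) x) x' (complexStructure x' v) =
      complexStructure (E := F) (extChartAt 𝓘(ℝ, F) x x')
        (mfderiv 𝓘(ℝ, F) 𝓘(ℝ, F) (extChartAt 𝓘(ℝ, F) x) x' v) :=
  (mdifferentiableAt_extChartAt (I := 𝓘(ℂ, F)) hx').mfderiv_complexStructure v

end ComplexDerivative

/-! ### The metric and the fundamental form in charts -/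

section MetricInChart

/-- A left inverse of `T` makes `f` and `T ∘ f` differentiable at the same points, so elsewhere both
sides take the default value zero. Pointwise symmetries of the metric thus pass to its derivative
without any differentiability proof. -/
theorem fderiv_comp_of_injective {V W G : Type*} [NormedAddCommGroup V] [NormedSpace ℝ V]
    [FiniteDimensional ℝ V] [NormedAddCommGroup W] [NormedSpace ℝ W] [FiniteDimensional ℝ W]
    [NormedAddCommGroup G] [NormedSpace ℝ G]
    (T : V →ₗ[ℝ] W) (hT : Function.Injective T) (f : G → V) (y w : G) :
    fderiv ℝ (fun z => T (f z)) y w = T (fderiv ℝ f y w) := by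
  by_cases hf : DifferentiableAt ℝ f y
  · have h := (T.toContinuousLinearMap.hasFDerivAt.comp y hf.hasFDerivAt).fderiv
    exact congrArg (fun L : G →L[ℝ] W => L w) h
  · obtain ⟨S, hS⟩ := LinearMap.exists_leftInverse_of_injective T (LinearMap.ker_eq_bot.2 hT)
    have hTf : ¬ DifferentiableAt ℝ (fun z => T (f z)) y := by
      intro h
      apply hf
      have hST : (fun z => S.toContinuousLinearMap (T (f z))) = f := by
        funext z
        exact LinearMap.congr_fun hS (f z)
      rw [← hST]
      exact S.toContinuousLinearMap.differentiableAt.comp y h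
    rw [fderiv_zero_of_not_differentiableAt hf, fderiv_zero_of_not_differentiableAt hTf]
    simp

section Real

variable {F : Type*} [NormedAddCommGroup F] [NormedSpace ℝ F]
  {X : Type*} [TopologicalSpace X] [ChartedSpace F X] [IsManifold 𝓘(ℝ, F) ∞ X]

theorem metricInChart_apply (g : SmoothMetric F X) (x : X) (y u v : F) :
    metricInChart g x y u v = g.inner ((extChartAt 𝓘(ℝ, F) x).symm y)
      (mfderiv 𝓘(ℝ, F) 𝓘(ℝ, F) (extChartAt 𝓘(ℝ, F) x).symm y u)
      (mfderiv 𝓘(ℝ, F) 𝓘(ℝ, F) (extChartAt 𝓘(ℝ, F) x).symm y v) :=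
  rfl

theorem metricInChart_symm (g : SmoothMetric F X) (x : X) (y u v : F) :
    metricInChart g x y u v = metricInChart g x y v u := by
  rw [metricInChart_apply, metricInChart_apply]
  exact g.symm _ _ _

theorem fderiv_metricInChart_symm [FiniteDimensional ℝ F] (g : SmoothMetric F X) (x : X)
    (y w u v : F) :
    fderiv ℝ (metricInChart g x) y w u v = fderiv ℝ (metricInChart g x) y w v u := by
  let T : (F →L[ℝ] F →L[ℝ] ℝ) →ₗ[ℝ] F →L[ℝ] F →L[ℝ] ℝ :=
    { toFun B := B.flip, map_add' _ _ := rfl, map_smul' _ _ := rfl }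
  have hT : Function.Injective T := fun B B' h => by
    rw [← B.flip_flip, ← B'.flip_flip]
    exact congrArg ContinuousLinearMap.flip h
  have h : (fun z => T (metricInChart g x z)) = metricInChart g x := by
    funext z
    ext a b
    exact metricInChart_symm g x z b a
  have h2 := fderiv_comp_of_injective (V := F →L[ℝ] F →L[ℝ] ℝ)
    (W := F →L[ℝ] F →L[ℝ] ℝ) T hT (metricInChart g x) y w
  rw [h] at h2
  exact congrArg (fun B : F →L[ℝ] F →L[ℝ] ℝ => B u v) h2

theorem metricInChart_injective (g : SmoothMetric F X) (x : X) :
    Function.Injective (metricInChart g x (extChartAt 𝓘(ℝ, F) x x)) := by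
  have hA := isInvertible_mfderivWithin_extChartAt_symm (I := 𝓘(ℝ, F)) (x := x)
    (mem_extChartAt_target x)
  rw [ModelWithCorners.range_eq_univ, mfderivWithin_univ] at hA
  rw [injective_iff_map_eq_zero]
  intro v hv
  by_contra hne
  have hAv : mfderiv 𝓘(ℝ, F) 𝓘(ℝ, F) (extChartAt 𝓘(ℝ, F) x).symm (extChartAt 𝓘(ℝ, F) x x) v ≠ 0 :=
    fun h0 => hne (hA.injective (h0.trans (map_zero _).symm))
  have hpos := g.pos _ _ hAv
  have h0 : metricInChart g x (extChartAt 𝓘(ℝ, F) x x) v v = 0 := by rw [hv]; rfl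
  exact hpos.ne' h0

/-- Ensures that `inverse` in `christoffel` is a true inverse at the chart centre, not its default
value. -/
theorem metricInChart_isInvertible [FiniteDimensional ℝ F] (g : SmoothMetric F X) (x : X) :
    (metricInChart g x (extChartAt 𝓘(ℝ, F) x x)).IsInvertible := by
  have hdim : Module.finrank ℝ F = Module.finrank ℝ (F →L[ℝ] ℝ) := by
    rw [← LinearMap.toContinuousLinearMap.finrank_eq]
    exact (Subspace.dual_finrank_eq).symm
  let e := LinearEquiv.ofInjectiveOfFinrankEq
    (metricInChart g x (extChartAt 𝓘(ℝ, F) x x) : F →ₗ[ℝ] F →L[ℝ] ℝ)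
    (metricInChart_injective g x) hdim
  exact ⟨e.toContinuousLinearEquiv, by ext; rfl⟩

end Real

variable {F : Type*} [NormedAddCommGroup F] [NormedSpace ℂ F]
  {X : Type*} [TopologicalSpace X] [ChartedSpace F X] [IsManifold 𝓘(ℂ, F) ω X]

theorem HermitianMetric.metricInChart_I_smul (g : HermitianMetric F X) {x : X} {y : F}
    (hy : y ∈ (extChartAt 𝓘(ℝ, F) x).target) (u v : F) :
    metricInChart g.toSmoothMetric x y (Complex.I • u) (Complex.I • v) =
      metricInChart g.toSmoothMetric x y u v := by
  rw [metricInChart_apply, metricInChart_apply, mfderiv_extChartAt_symm_complexStructure hy,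
    mfderiv_extChartAt_symm_complexStructure hy]
  exact g.invariant _ _ _

theorem HermitianMetric.fundamentalFormInChart_apply (g : HermitianMetric F X) {x : X} {y : F}
    (hy : y ∈ (extChartAt 𝓘(ℝ, F) x).target) (u v : F) :
    g.fundamentalFormInChart x y ![u, v] =
      metricInChart g.toSmoothMetric x y (Complex.I • u) v := by
  rw [metricInChart_apply, mfderiv_extChartAt_symm_complexStructure hy]
  rfl

section Alternating

theorem update_pair_zero {V : Type*} (u v a : V) : Function.update ![u, v] 0 a = ![a, v] := by
  ext i
  fin_cases i <;> simp

theorem update_pair_one {V : Type*} (u v a : V) :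
    Function.update ![u, v] 1 a = ![u, a] := by
  ext i
  fin_cases i <;> simp

variable {V : Type*} [NormedAddCommGroup V] [NormedSpace ℝ V] (η : V [⋀^Fin 2]→L[ℝ] ℝ)

theorem alternating_pair_add_left (u u' v : V) :
    η ![u + u', v] = η ![u, v] + η ![u', v] := by
  simpa only [update_pair_zero] using η.map_update_add ![0, v] 0 u u'

theorem alternating_pair_smul_left (c : ℝ) (u v : V) :
    η ![c • u, v] = c • η ![u, v] := by
  simpa only [update_pair_zero] using η.map_update_smul ![0, v] 0 c u

theorem alternating_pair_add_right (u v v' : V) :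
    η ![u, v + v'] = η ![u, v] + η ![u, v'] := by
  simpa only [update_pair_one] using η.map_update_add ![u, 0] 1 v v'

theorem alternating_pair_smul_right (c : ℝ) (u v : V) :
    η ![u, c • v] = c • η ![u, v] := by
  simpa only [update_pair_one] using η.map_update_smul ![u, 0] 1 c v

end Alternating

variable [FiniteDimensional ℂ F]

/-- The bilinear map `(u, v) ↦ η (u, i v)` attached to an alternating form `η`. -/
noncomputable def alternatingToBilin (F : Type*) [NormedAddCommGroup F] [NormedSpace ℂ F]
    [FiniteDimensional ℂ F] : (F [⋀^Fin 2]→L[ℝ] ℝ) →ₗ[ℝ] F →L[ℝ] F →L[ℝ] ℝ where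
  toFun η := LinearMap.toContinuousBilinearMap
    (LinearMap.mk₂ ℝ (fun u v => η ![u, Complex.I • v])
      (fun u u' v => alternating_pair_add_left η u u' _)
      (fun c u v => alternating_pair_smul_left η c u _)
      (fun u v v' => by rw [smul_add, alternating_pair_add_right])
      (fun c u v => by rw [smul_comm, alternating_pair_smul_right]))
  map_add' _ _ := rfl
  map_smul' _ _ := rfl

theorem alternatingToBilin_apply (η : F [⋀^Fin 2]→L[ℝ] ℝ) (u v : F) :
    alternatingToBilin F η u v = η ![u, Complex.I • v] :=
  rfl

theorem alternatingToBilin_injective : Function.Injective (alternatingToBilin F) := by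
  intro η η' h
  ext v
  -- The second argument is chosen so that multiplying it by i returns `v 1`.
  have h2 : alternatingToBilin F η (v 0) (-(Complex.I • v 1)) =
      alternatingToBilin F η' (v 0) (-(Complex.I • v 1)) := by rw [h]
  rw [alternatingToBilin_apply, alternatingToBilin_apply] at h2
  have h3 : ![v 0, Complex.I • (-(Complex.I • v 1))] = v := by
    ext i
    fin_cases i <;> simp [smul_smul]
  rwa [h3] at h2

instance finiteDimensional_alternating_two : FiniteDimensional ℝ (F [⋀^Fin 2]→L[ℝ] ℝ) :=
  FiniteDimensional.of_injective (V₂ := F →L[ℝ] F →L[ℝ] ℝ) (alternatingToBilin F) alternatingToBilin_injective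

/-- Near the centre ω(u, Jv) = g(Ju, Jv) = g(u, v), so the twist by J turns the fundamental form
into the metric. -/
theorem HermitianMetric.fderiv_fundamentalFormInChart (g : HermitianMetric F X) (x : X)
    (w u v : F) :
    fderiv ℝ (g.fundamentalFormInChart x) (extChartAt 𝓘(ℝ, F) x x) w ![u, Complex.I • v] =
      fderiv ℝ (metricInChart g.toSmoothMetric x) (extChartAt 𝓘(ℝ, F) x x) w u v := by
  have h := fderiv_comp_of_injective (W := F →L[ℝ] F →L[ℝ] ℝ) (alternatingToBilin F)
    alternatingToBilin_injective
    (g.fundamentalFormInChart x) (extChartAt 𝓘(ℝ, F) x x) w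
  have heq : (fun z => alternatingToBilin F (g.fundamentalFormInChart x z))
      =ᶠ[𝓝 (extChartAt 𝓘(ℝ, F) x x)] metricInChart g.toSmoothMetric x := by
    filter_upwards [extChartAt_target_mem_nhds (I := 𝓘(ℝ, F)) x] with z hz
    ext a b
    rw [alternatingToBilin_apply, g.fundamentalFormInChart_apply hz]
    exact g.metricInChart_I_smul hz a b
  rw [heq.fderiv_eq] at h
  rw [h]
  rfl

theorem HermitianMetric.fderiv_metricInChart_I_smul (g : HermitianMetric F X) (x : X)
    (w u v : F) :
    fderiv ℝ (metricInChart g.toSmoothMetric x) (extChartAt 𝓘(ℝ, F) x x) w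
        (Complex.I • u) (Complex.I • v) =
      fderiv ℝ (metricInChart g.toSmoothMetric x) (extChartAt 𝓘(ℝ, F) x x) w u v := by
  let J : F →L[ℝ] F := Complex.I • ContinuousLinearMap.id ℝ F
  let T : (F →L[ℝ] F →L[ℝ] ℝ) →ₗ[ℝ] F →L[ℝ] F →L[ℝ] ℝ :=
    { toFun B := B.bilinearComp J J, map_add' _ _ := rfl, map_smul' _ _ := rfl }
  have hT : Function.Injective T := fun B B' h => by
    ext a b
    have h2 : B (Complex.I • -(Complex.I • a)) (Complex.I • -(Complex.I • b)) =
        B' (Complex.I • -(Complex.I • a)) (Complex.I • -(Complex.I • b)) :=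
      congrArg (fun C : F →L[ℝ] F →L[ℝ] ℝ => C (-(Complex.I • a)) (-(Complex.I • b))) h
    simpa [smul_smul] using h2
  have heq : (fun z => T (metricInChart g.toSmoothMetric x z))
      =ᶠ[𝓝 (extChartAt 𝓘(ℝ, F) x x)] metricInChart g.toSmoothMetric x := by
    filter_upwards [extChartAt_target_mem_nhds (I := 𝓘(ℝ, F)) x] with z hz
    ext a b
    exact g.metricInChart_I_smul hz a b
  have h := fderiv_comp_of_injective (V := F →L[ℝ] F →L[ℝ] ℝ)
    (W := F →L[ℝ] F →L[ℝ] ℝ) T hT (metricInChart g.toSmoothMetric x)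
    (extChartAt 𝓘(ℝ, F) x x) w
  rw [heq.fderiv_eq] at h
  exact (congrArg (fun B : F →L[ℝ] F →L[ℝ] ℝ => B u v) h).symm

end MetricInChart

/-! ### Closedness of ω and the type (1,1) Christoffel symbols -/

section Kahler

theorem koszulForm_apply {F : Type*} [NormedAddCommGroup F] [NormedSpace ℝ F]
    {X : Type*} [TopologicalSpace X] [ChartedSpace F X] [IsManifold 𝓘(ℝ, F) ∞ X]
    (g : SmoothMetric F X) (x : X) (y u v w : F) :
    koszulForm g x y u v w = fderiv ℝ (metricInChart g x) y u v w +
      fderiv ℝ (metricInChart g x) y v u w - fderiv ℝ (metricInChart g x) y w u v :=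
  rfl

variable {F : Type*} [NormedAddCommGroup F] [NormedSpace ℂ F]

theorem I_smul_I_smul (v : F) : Complex.I • Complex.I • v = -v := by
  rw [smul_smul, Complex.I_mul_I, neg_one_smul]

/-- For a derivative `D` of Hermitian metrics, closedness of the fundamental form is equivalent to
the vanishing of the trace of the Koszul form on complex lines. -/
theorem closed_iff_koszul_of_hermitian (D : F →L[ℝ] F →L[ℝ] F →L[ℝ] ℝ)
    (hsymm : ∀ w u v, D w u v = D w v u)
    (hJ : ∀ w u v, D w (Complex.I • u) (Complex.I • v) = D w u v) :
    (∀ u v w, D u (Complex.I • v) w - D v (Complex.I • u) w + D w (Complex.I • u) v = 0) ↔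
      ∀ u v w, (D u v w + D v u w - D w u v) +
        (D (Complex.I • u) (Complex.I • v) w + D (Complex.I • v) (Complex.I • u) w -
          D w (Complex.I • u) (Complex.I • v)) = 0 := by
  have hskew : ∀ w u v, D w (Complex.I • u) v = -D w u (Complex.I • v) := by
    intro w u v
    rw [← hJ w (Complex.I • u) v, I_smul_I_smul, map_neg]
    rfl
  constructor
  · intro h u v w
    -- The goal is minus the sum of the closedness identities for (u, Jv, w) and (v, Ju, w).
    have h1 := h u (Complex.I • v) w
    have h2 := h v (Complex.I • u) w
    rw [I_smul_I_smul] at h1 h2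
    simp only [map_neg, neg_apply] at h1 h2
    rw [hJ] at h1 h2 ⊢
    rw [hsymm w v u] at h2
    linarith
  · intro h u v w
    have halt : ∀ a b c, D a (Complex.I • b) c = -D a (Complex.I • c) b := fun a b c => by
      rw [hskew a b c, hsymm a b]
    have hcyc : ∀ a b c, D a (Complex.I • b) c + D (Complex.I • b) a c -
        D (Complex.I • a) b c - D b (Complex.I • a) c + 2 * D c (Complex.I • a) b = 0 := by
      intro a b c
      have hab := h a (Complex.I • b) c
      rw [I_smul_I_smul] at hab
      simp only [map_neg, neg_apply] at hab
      linarith [hskew c a b]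
    -- In the cyclic sum of `hcyc` the derivatives along Ju, Jv, Jw cancel by symmetry, and four
    -- times the left side of the closedness identity remains.
    linarith [hcyc v w u, hcyc w u v, hcyc u v w, halt u v w, halt v w u, halt w u v,
      hsymm (Complex.I • u) v w, hsymm (Complex.I • v) w u, hsymm (Complex.I • w) u v]

variable [FiniteDimensional ℂ F]
  {X : Type*} [TopologicalSpace X] [ChartedSpace F X] [IsManifold 𝓘(ℂ, F) ω X]

theorem HermitianMetric.fderiv_fundamentalFormInChart_apply (g : HermitianMetric F X) (x : X)
    (w u v : F) :
    fderiv ℝ (g.fundamentalFormInChart x) (extChartAt 𝓘(ℝ, F) x x) w ![u, v] =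
      fderiv ℝ (metricInChart g.toSmoothMetric x) (extChartAt 𝓘(ℝ, F) x x) w
        (Complex.I • u) v := by
  rw [← g.fderiv_metricInChart_I_smul, I_smul_I_smul, ← g.fderiv_fundamentalFormInChart x w (-u),
    I_smul_I_smul, ← neg_one_smul ℝ u, ← neg_one_smul ℝ v, alternating_pair_smul_left,
    alternating_pair_smul_right]
  simp

theorem HermitianMetric.extDeriv_fundamentalFormInChart_apply (g : HermitianMetric F X) (x : X)
    (v : Fin 3 → F) :
    extDeriv (g.fundamentalFormInChart x) (extChartAt 𝓘(ℝ, F) x x) v =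
      fderiv ℝ (metricInChart g.toSmoothMetric x) (extChartAt 𝓘(ℝ, F) x x) (v 0)
          (Complex.I • v 1) (v 2) -
        fderiv ℝ (metricInChart g.toSmoothMetric x) (extChartAt 𝓘(ℝ, F) x x) (v 1)
          (Complex.I • v 0) (v 2) +
        fderiv ℝ (metricInChart g.toSmoothMetric x) (extChartAt 𝓘(ℝ, F) x x) (v 2)
          (Complex.I • v 0) (v 1) := by
  have h0 : Fin.removeNth 0 v = ![v 1, v 2] := by
    ext i; fin_cases i <;> rfl
  have h1 : Fin.removeNth 1 v = ![v 0, v 2] := by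
    ext i; fin_cases i <;> rfl
  have h2 : Fin.removeNth 2 v = ![v 0, v 1] := by
    ext i; fin_cases i <;> rfl
  rw [extDeriv, ContinuousAlternatingMap.alternatizeUncurryFin_apply, Fin.sum_univ_three, h0, h1, h2,
    g.fderiv_fundamentalFormInChart_apply, g.fderiv_fundamentalFormInChart_apply,
    g.fderiv_fundamentalFormInChart_apply]
  simp
  ring

/-- A Hermitian metric is Kähler if and only if its Christoffel symbols at the centre of each chart
vanish in type `(1, 1)`. -/
theorem HermitianMetric.isKahler_iff_christoffel (g : HermitianMetric F X) :
    g.IsKahler ↔ ∀ (x : X) (u v : F),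
      christoffel g.toSmoothMetric x (extChartAt 𝓘(ℝ, F) x x) u v +
        christoffel g.toSmoothMetric x (extChartAt 𝓘(ℝ, F) x x) (Complex.I • u)
          (Complex.I • v) = 0 := by
  refine forall_congr' fun x => ?_
  set y := extChartAt 𝓘(ℝ, F) x x
  obtain ⟨e, he⟩ := metricInChart_isInvertible g.toSmoothMetric x
  have h1 : extDeriv (g.fundamentalFormInChart x) y = 0 ↔ ∀ u v w : F,
      fderiv ℝ (metricInChart g.toSmoothMetric x) y u (Complex.I • v) w -
        fderiv ℝ (metricInChart g.toSmoothMetric x) y v (Complex.I • u) w +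
        fderiv ℝ (metricInChart g.toSmoothMetric x) y w (Complex.I • u) v = 0 := by
    constructor
    · intro h u v w
      have h2 := g.extDeriv_fundamentalFormInChart_apply x ![u, v, w]
      rw [h] at h2
      exact h2.symm
    · intro h
      ext v
      exact (g.extDeriv_fundamentalFormInChart_apply x v).trans (h _ _ _)
  rw [h1, closed_iff_koszul_of_hermitian _ (fderiv_metricInChart_symm _ x y)
    (g.fderiv_metricInChart_I_smul x)]
  refine forall_congr' fun u => forall_congr' fun v => ?_
  rw [christoffel, christoffel, ← smul_add, smul_eq_zero_iff_right (by norm_num), ← map_add, ← he,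
    ContinuousLinearMap.inverse_equiv]
  refine Iff.trans ?_ (e.symm.map_eq_zero_iff).symm
  constructor
  · intro h
    ext w
    exact h w
  · intro h w
    exact congrArg (fun L : F →L[ℝ] ℝ => L w) h

end Kahler

/-! ### The pluriharmonic equation for ±holomorphic maps -/

section PluriharmonicEquation

section Christoffel

variable {F : Type*} [NormedAddCommGroup F] [NormedSpace ℝ F]
  {X : Type*} [TopologicalSpace X] [ChartedSpace F X] [IsManifold 𝓘(ℝ, F) ∞ X]
  (g : SmoothMetric F X) (x : X) (y : F)

theorem christoffel_add_left (u u' v : F) :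
    christoffel g x y (u + u') v = christoffel g x y u v + christoffel g x y u' v := by
  rw [christoffel, christoffel, christoffel, ← smul_add, ← map_add]
  congr 2
  ext w
  simp only [koszulForm_apply, add_apply, map_add]
  ring

theorem christoffel_smul_left (c : ℝ) (u v : F) :
    christoffel g x y (c • u) v = c • christoffel g x y u v := by
  have h : koszulForm g x y (c • u) v = c • koszulForm g x y u v := by
    ext w
    simp only [koszulForm_apply, smul_apply, map_smul, smul_eq_mul]
    ring
  rw [christoffel, christoffel, h, map_smul, smul_comm]

theorem christoffel_comm [FiniteDimensional ℝ F] (u v : F) :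
    christoffel g x y u v = christoffel g x y v u := by
  have h : koszulForm g x y u v = koszulForm g x y v u := by
    ext w
    rw [koszulForm_apply, koszulForm_apply, fderiv_metricInChart_symm g x y w u v]
    ring
  rw [christoffel, christoffel, h]

theorem christoffel_smul_right [FiniteDimensional ℝ F] (c : ℝ) (u v : F) :
    christoffel g x y u (c • v) = c • christoffel g x y u v := by
  rw [christoffel_comm, christoffel_smul_left, christoffel_comm]

theorem christoffel_add_right [FiniteDimensional ℝ F] (u v v' : F) :
    christoffel g x y u (v + v') = christoffel g x y u v + christoffel g x y u v' := by
  rw [christoffel_comm, christoffel_add_left, christoffel_comm g x y v, christoffel_comm g x y v']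

theorem christoffel_neg_right [FiniteDimensional ℝ F] (u v : F) :
    christoffel g x y u (-v) = -christoffel g x y u v := by
  rw [← neg_one_smul ℝ v, christoffel_smul_right, neg_one_smul]

end Christoffel

theorem christoffel_flatMetricComplex (x y u v : ℂ) :
    christoffel flatMetricComplex x y u v = 0 := by
  have hconst : metricInChart flatMetricComplex x = fun _ => innerSL ℝ := by
    funext z
    ext a b
    rw [metricInChart_apply]
    have hid : mfderiv 𝓘(ℝ, ℂ) 𝓘(ℝ, ℂ) (extChartAt 𝓘(ℝ, ℂ) x).symm z =
        ContinuousLinearMap.id ℝ ℂ := by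
      exact mfderiv_id
    rw [hid]
    rfl
  have hK : koszulForm flatMetricComplex x y u v = 0 := by
    ext w
    rw [koszulForm_apply, hconst]
    simp
  rw [christoffel, hK, map_zero, smul_zero]

variable {E : Type*} [NormedAddCommGroup E] [NormedSpace ℂ E]
  {F : Type*} [NormedAddCommGroup F] [NormedSpace ℂ F]

theorem Cplx.IsType10.snd_eq {Z : Cplx E} (hZ : Z.IsType10) : Z.2 = -(Complex.I • Z.1) := by
  have h : Complex.I • Z.1 = -Z.2 := congrArg Prod.fst hZ
  rw [h, neg_neg]

theorem Cplx.isType10_mk (a : E) : Cplx.IsType10 ((a, -(Complex.I • a)) : Cplx E) := by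
  rw [Cplx.IsType10, Cplx.mulI]
  simp [I_smul_I_smul]

/-- The Hessian of a map whose derivative is complex linear or antilinear. -/
theorem fderiv_fderiv_I_smul {f : E → F} {y : E} (hf : ContDiffAt ℝ ∞ f y) {ε : ℝ}
    (hJ : ∀ᶠ z in 𝓝 y, ∀ v, fderiv ℝ f z (Complex.I • v) = ε • Complex.I • fderiv ℝ f z v)
    (a b : E) :
    fderiv ℝ (fderiv ℝ f) y a (Complex.I • b) =
      ε • Complex.I • fderiv ℝ (fderiv ℝ f) y a b := by
  have hd : DifferentiableAt ℝ (fderiv ℝ f) y :=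
    (hf.fderiv_right (m := 1) (by norm_cast)).differentiableAt (by norm_num)
  let L : F →L[ℝ] F := ε • Complex.I • ContinuousLinearMap.id ℝ F
  have h1 : HasFDerivAt (fun z => fderiv ℝ f z (Complex.I • b))
      ((fderiv ℝ (fderiv ℝ f) y).flip (Complex.I • b)) y := by
    simpa using hd.hasFDerivAt.clm_apply (hasFDerivAt_const (Complex.I • b) y)
  have h2 : HasFDerivAt (fun z => fderiv ℝ f z b) ((fderiv ℝ (fderiv ℝ f) y).flip b) y := by
    simpa using hd.hasFDerivAt.clm_apply (hasFDerivAt_const b y)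
  have h3 : HasFDerivAt (fun z => fderiv ℝ f z (Complex.I • b))
      (L ∘L (fderiv ℝ (fderiv ℝ f) y).flip b) y :=
    (L.hasFDerivAt.comp y h2).congr_of_eventuallyEq (hJ.mono fun z hz => hz b)
  exact congrArg (fun A : E →L[ℝ] F => A a) (h1.unique h3)

/-- For a map whose derivative is complex linear or antilinear, the second order terms of the
pluriharmonic equation cancel. -/
theorem deriv_mapLinear_fderiv {f : E → F} {y : E} (hf : ContDiffAt ℝ ∞ f y) {ε : ℝ}
    (hε : ε * ε = 1)
    (hJ : ∀ᶠ z in 𝓝 y, ∀ v, fderiv ℝ f z (Complex.I • v) = ε • Complex.I • fderiv ℝ f z v)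
    {Z : Cplx E} {W : E → Cplx E} (hZ : Z.IsType10) (hW : ContDiffAt ℝ ∞ W y)
    (hWy : (W y).IsType10) :
    Cplx.deriv (fun z => Cplx.mapLinear (fderiv ℝ f z) (W z)) y Z.conj =
      Cplx.mapLinear (fderiv ℝ f y) (Cplx.deriv W y Z.conj) := by
  have hd : DifferentiableAt ℝ (fderiv ℝ f) y :=
    (hf.fderiv_right (m := 1) (by norm_cast)).differentiableAt (by norm_num)
  have hdW : DifferentiableAt ℝ W y := hW.differentiableAt (by simp)
  have hS : ∀ a, fderiv ℝ (fun z => Cplx.mapLinear (fderiv ℝ f z) (W z)) y a =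
      (fderiv ℝ (fderiv ℝ f) y a (W y).1 + fderiv ℝ f y (fderiv ℝ W y a).1,
        fderiv ℝ (fderiv ℝ f) y a (W y).2 + fderiv ℝ f y (fderiv ℝ W y a).2) := by
    intro a
    have h := (hd.hasFDerivAt.clm_apply hdW.hasFDerivAt.fst).prodMk
      (hd.hasFDerivAt.clm_apply hdW.hasFDerivAt.snd)
    have h2 : fderiv ℝ (fun z => Cplx.mapLinear (fderiv ℝ f z) (W z)) y = _ := h.fderiv
    rw [h2]
    simp [add_comm]
  have hH := fderiv_fderiv_I_smul hf hJ
  have hsymm : ∀ a b, fderiv ℝ (fderiv ℝ f) y a b = fderiv ℝ (fderiv ℝ f) y b a :=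
    hf.isSymmSndFDerivAt (by
      rw [minSmoothness_of_isRCLikeNormedField]
      norm_cast)
  have hIa : ∀ a b, fderiv ℝ (fderiv ℝ f) y (Complex.I • a) b =
      ε • Complex.I • fderiv ℝ (fderiv ℝ f) y a b := by
    intro a b
    rw [hsymm, hH, hsymm b a]
  -- Moving i out of both slots of the Hessian H gives H(Ja, Jb) = -H(a, b), for either sign. This
  -- cancels the Hessian terms for Z̄ = a + iJa and W = b - iJb.
  have hII : ∀ v : F, ε • Complex.I • ε • Complex.I • v = -v := by
    intro v
    rw [smul_comm Complex.I ε, I_smul_I_smul, smul_smul, hε, one_smul]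
  obtain ⟨a, a'⟩ := Z
  obtain rfl : a' = -(Complex.I • a) := hZ.snd_eq
  rw [Cplx.deriv, Cplx.deriv, hS, hS, hWy.snd_eq]
  simp only [Cplx.conj, Cplx.mulI, Cplx.mapLinear, neg_neg, map_neg, smul_neg, hH, hIa, hII,
    Prod.mk_add_mk,
    Prod.fst_add, Prod.snd_add, map_add]
  ext <;> simp only [] <;> abel

theorem writtenInExtChartAt_center {N : Type*} [TopologicalSpace N] [ChartedSpace E N]
    {X : Type*} [TopologicalSpace X] [ChartedSpace F X] (φ : N → X) (p : N) :
    writtenInExtChartAt 𝓘(ℝ, E) 𝓘(ℝ, F) p φ (extChartAt 𝓘(ℝ, E) p p) =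
      extChartAt 𝓘(ℝ, F) (φ p) (φ p) := by
  simp [writtenInExtChartAt]

variable [FiniteDimensional ℂ F]
  {N : Type*} [TopologicalSpace N] [ChartedSpace E N]
  {X : Type*} [TopologicalSpace X] [ChartedSpace F X] [IsManifold 𝓘(ℂ, F) ω X]

/-- The Christoffel symbols of `g` at the centre of the chart at `x` vanish in type `(1, 1)`. -/
def ChristoffelType11Vanishes (g : SmoothMetric F X) (x : X) : Prop :=
  ∀ u v : F, christoffel g x (extChartAt 𝓘(ℝ, F) x x) u v +
    christoffel g x (extChartAt 𝓘(ℝ, F) x x) (Complex.I • u) (Complex.I • v) = 0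

/-- Local form of the conditions satisfied at `p` by a map that is holomorphic (`ε = 1`) or
antiholomorphic (`ε = -1`) near `p`. -/
structure IsPMHolomorphicInChartAt (E : Type*) [NormedAddCommGroup E] [NormedSpace ℂ E]
    (F : Type*) [NormedAddCommGroup F] [NormedSpace ℂ F]
    {N : Type*} [TopologicalSpace N] [ChartedSpace E N]
    {X : Type*} [TopologicalSpace X] [ChartedSpace F X] (φ : N → X) (p : N) (ε : ℝ) : Prop where
  sq_eq_one : ε * ε = 1
  contDiffAt : ContDiffAt ℝ ∞ (writtenInExtChartAt 𝓘(ℝ, E) 𝓘(ℝ, F) p φ) (extChartAt 𝓘(ℝ, E) p p)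
  fderiv_I_smul : ∀ᶠ z in 𝓝 (extChartAt 𝓘(ℝ, E) p p), ∀ v,
    fderiv ℝ (writtenInExtChartAt 𝓘(ℝ, E) 𝓘(ℝ, F) p φ) z (Complex.I • v) =
      ε • Complex.I • fderiv ℝ (writtenInExtChartAt 𝓘(ℝ, E) 𝓘(ℝ, F) p φ) z v

theorem IsPMHolomorphicInChartAt.isPluriharmonicAt {φ : N → X} {p : N} {ε : ℝ}
    (hφ : IsPMHolomorphicInChartAt E F φ p ε) {g : SmoothMetric F X}
    (hg : ChristoffelType11Vanishes g (φ p)) : IsPluriharmonicAt E g φ p := by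
  intro Z W hZ hW hW10
  rw [pullbackCovDeriv, deriv_mapLinear_fderiv hφ.contDiffAt hφ.sq_eq_one hφ.fderiv_I_smul hZ hW
    hW10.self_of_nhds, add_sub_cancel_left, writtenInExtChartAt_center]
  obtain ⟨a, a'⟩ := Z
  obtain rfl : a' = -(Complex.I • a) := hZ.snd_eq
  have hJ := hφ.fderiv_I_smul.self_of_nhds
  simp only [Cplx.mapBilinear, Cplx.mapLinear, Cplx.conj, neg_neg, hW10.self_of_nhds.snd_eq, map_neg,
    hJ]
  generalize fderiv ℝ (writtenInExtChartAt 𝓘(ℝ, E) 𝓘(ℝ, F) p φ) (extChartAt 𝓘(ℝ, E) p p) a = u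
  generalize fderiv ℝ (writtenInExtChartAt 𝓘(ℝ, E) 𝓘(ℝ, F) p φ) (extChartAt 𝓘(ℝ, E) p p)
    (W (extChartAt 𝓘(ℝ, E) p p)).1 = v
  -- With u, v the images of the real parts of Z and W, `h1` gives the real part of Γ(df Z̄, df W) =
  -- 0, and the pair (u, Jv) in `h2` gives the imaginary part.
  have h1 := hg u v
  have h2 := hg u (Complex.I • v)
  rw [I_smul_I_smul, christoffel_neg_right, ← sub_eq_add_neg, sub_eq_zero] at h2
  simp only [christoffel_neg_right, christoffel_smul_left, christoffel_smul_right, smul_smul,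
    hφ.sq_eq_one, one_smul, sub_neg_eq_add, h1, h2, neg_add_cancel]
  rfl

theorem IsPluriharmonicAt.christoffel_self {φ : N → X} {p : N} {ε : ℝ} {g : SmoothMetric F X}
    (h : IsPluriharmonicAt E g φ p) (hφ : IsPMHolomorphicInChartAt E F φ p ε) {a : E} {u : F}
    (hu : fderiv ℝ (writtenInExtChartAt 𝓘(ℝ, E) 𝓘(ℝ, F) p φ) (extChartAt 𝓘(ℝ, E) p p) a = u) :
    christoffel g (φ p) (extChartAt 𝓘(ℝ, F) (φ p) (φ p)) u u +
      christoffel g (φ p) (extChartAt 𝓘(ℝ, F) (φ p) (φ p)) (Complex.I • u) (Complex.I • u) = 0 := by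
  have hZ := Cplx.isType10_mk a
  -- Test with Z and a constant field W both equal to a - iJa; the real part of the equation is the
  -- claim.
  have h1 := h (a, -(Complex.I • a)) (fun _ => (a, -(Complex.I • a))) hZ contDiffAt_const
    (Filter.Eventually.of_forall fun _ => hZ)
  rw [pullbackCovDeriv, deriv_mapLinear_fderiv hφ.contDiffAt hφ.sq_eq_one hφ.fderiv_I_smul hZ
    contDiffAt_const hZ, add_sub_cancel_left, writtenInExtChartAt_center] at h1
  have hJ := hφ.fderiv_I_smul.self_of_nhds
  have h2 := congrArg Prod.fst h1
  simp only [Cplx.mapBilinear, Cplx.mapLinear, Cplx.conj, neg_neg, map_neg, hJ, hu,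
    christoffel_neg_right, christoffel_smul_left, christoffel_smul_right, smul_smul,
    hφ.sq_eq_one, one_smul, sub_neg_eq_add] at h2
  exact h2

/-- Polarisation, using that Γ is symmetric and bilinear. -/
theorem christoffelType11Vanishes_of_self {g : SmoothMetric F X} {x : X}
    (h : ∀ u : F, christoffel g x (extChartAt 𝓘(ℝ, F) x x) u u +
      christoffel g x (extChartAt 𝓘(ℝ, F) x x) (Complex.I • u) (Complex.I • u) = 0) :
    ChristoffelType11Vanishes g x := by
  intro u v
  have h1 := h (u + v)
  have h2 := h u
  have h3 := h v
  simp only [smul_add, christoffel_add_left, christoffel_add_right] at h1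
  rw [christoffel_comm g x _ v u, christoffel_comm g x _ (Complex.I • v) (Complex.I • u)] at h1
  have h4 : (2 : ℝ) • (christoffel g x (extChartAt 𝓘(ℝ, F) x x) u v +
      christoffel g x (extChartAt 𝓘(ℝ, F) x x) (Complex.I • u) (Complex.I • v)) = 0 := by
    linear_combination (norm := module) h1 - h2 - h3
  exact (smul_eq_zero_iff_right (by norm_num)).1 h4

end PluriharmonicEquation

/-! ### From maps of manifolds to their chart expressions, and test maps -/

section LocalExpression

variable {E : Type*} [NormedAddCommGroup E] [NormedSpace ℂ E]
  {N : Type*} [TopologicalSpace N] [ChartedSpace E N]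
  {F : Type*} [NormedAddCommGroup F] [NormedSpace ℂ F]
  {X : Type*} [TopologicalSpace X] [ChartedSpace F X]

theorem IsPMHolomorphicOn.contMDiffOn {φ : N → X} {U : Set N} (h : IsPMHolomorphicOn E F φ U) :
    ContMDiffOn 𝓘(ℝ, E) 𝓘(ℝ, F) ∞ φ U :=
  h.elim And.left And.left

theorem IsPMHolomorphicOn.exists_sign {φ : N → X} {U : Set N} (h : IsPMHolomorphicOn E F φ U) :
    ∃ ε : ℝ, ε * ε = 1 ∧ ∀ p ∈ U, ∀ v : TangentSpace 𝓘(ℝ, E) p,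
      mfderiv 𝓘(ℝ, E) 𝓘(ℝ, F) φ p (complexStructure p v) =
        ε • complexStructure (φ p) (mfderiv 𝓘(ℝ, E) 𝓘(ℝ, F) φ p v) := by
  rcases h with h | h
  · exact ⟨1, one_mul 1, fun p hp v => by rw [h.2 p hp v, one_smul]⟩
  · exact ⟨-1, by norm_num, fun p hp v => by rw [h.2 p hp v, neg_one_smul]⟩

variable [IsManifold 𝓘(ℂ, E) ω N] [IsManifold 𝓘(ℂ, F) ω X]

/-- The charts are holomorphic, so J passes through each factor of the chart expression, and only
the middle factor dφ contributes the sign. -/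
theorem IsPMHolomorphicOn.inChartAt {φ : N → X} {U : Set N} (hU : IsOpen U)
    (h : IsPMHolomorphicOn E F φ U) {p : N} (hp : p ∈ U) :
    ∃ ε, IsPMHolomorphicInChartAt E F φ p ε := by
  obtain ⟨ε, hε, hJ⟩ := h.exists_sign
  have hsm := h.contMDiffOn.contMDiffAt (hU.mem_nhds hp)
  refine ⟨ε, hε, ?_, ?_⟩
  · have h1 := (contMDiffAt_iff.1 hsm).2
    rwa [ModelWithCorners.range_eq_univ, contDiffWithinAt_univ] at h1
  · have hcont : ContinuousAt (extChartAt 𝓘(ℝ, E) p).symm (extChartAt 𝓘(ℝ, E) p p) :=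
      continuousAt_extChartAt_symm p
    have hsrc : U ∩ φ ⁻¹' (chartAt F (φ p)).source ∈ 𝓝 p :=
      Filter.inter_mem (hU.mem_nhds hp)
        (hsm.continuousAt.preimage_mem_nhds (chart_source_mem_nhds F (φ p)))
    filter_upwards [extChartAt_target_mem_nhds (I := 𝓘(ℝ, E)) p,
      hcont.preimage_mem_nhds (by rwa [extChartAt_to_inv])] with z hz hzU v
    set q := (extChartAt 𝓘(ℝ, E) p).symm z
    have d1 : MDifferentiableAt 𝓘(ℝ, E) 𝓘(ℝ, E) (extChartAt 𝓘(ℝ, E) p).symm z :=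
      mdifferentiableAt_extChartAt_symm hz
    have d2 : MDifferentiableAt 𝓘(ℝ, E) 𝓘(ℝ, F) φ q :=
      (h.contMDiffOn.contMDiffAt (hU.mem_nhds hzU.1)).mdifferentiableAt (by simp)
    have d3 : MDifferentiableAt 𝓘(ℝ, F) 𝓘(ℝ, F) (extChartAt 𝓘(ℝ, F) (φ p)) (φ q) :=
      mdifferentiableAt_extChartAt hzU.2
    have hcomp : ∀ w : E, fderiv ℝ (writtenInExtChartAt 𝓘(ℝ, E) 𝓘(ℝ, F) p φ) z w =
        mfderiv 𝓘(ℝ, F) 𝓘(ℝ, F) (extChartAt 𝓘(ℝ, F) (φ p)) (φ q)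
          (mfderiv 𝓘(ℝ, E) 𝓘(ℝ, F) φ q
            (mfderiv 𝓘(ℝ, E) 𝓘(ℝ, E) (extChartAt 𝓘(ℝ, E) p).symm z w)) := by
      intro w
      rw [← mfderiv_eq_fderiv]
      have e1 := mfderiv_comp z (d3.comp q d2) d1
      have e2 := mfderiv_comp q d3 d2
      have e3 := congrArg (fun L : E →L[ℝ] F => L w) e1
      exact e3.trans (congrArg (fun L : E →L[ℝ] F =>
        L (mfderiv 𝓘(ℝ, E) 𝓘(ℝ, E) (extChartAt 𝓘(ℝ, E) p).symm z w)) e2)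
    rw [hcomp, hcomp, mfderiv_extChartAt_symm_complexStructure hz, hJ q hzU.1, map_smul]
    exact congrArg (ε • ·) (mfderiv_extChartAt_complexStructure hzU.2 _)

theorem IsPMHolomorphicOn.isPluriharmonicOn [FiniteDimensional ℂ F] {φ : N → X} {U : Set N}
    (hU : IsOpen U) (h : IsPMHolomorphicOn E F φ U) {g : SmoothMetric F X}
    (hg : ∀ x, ChristoffelType11Vanishes g x) : IsPluriharmonicOn E g φ U := by
  refine ⟨h.contMDiffOn, fun p hp => ?_⟩
  obtain ⟨ε, hε⟩ := h.inChartAt hU hp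
  exact hε.isPluriharmonicAt (hg _)

/-- There are holomorphic maps between open subsets of `N` and `X` through given points whose
differential takes a given value on a given nonzero vector. -/
theorem exists_isHolomorphicMapOn [FiniteDimensional ℂ E] (p : N) (x : X) {a : E} (ha : a ≠ 0)
    (u : F) :
    ∃ (U : Set N) (φ : N → X), IsOpen U ∧ p ∈ U ∧ IsHolomorphicMapOn E F φ U ∧ φ p = x ∧
      fderiv ℝ (writtenInExtChartAt 𝓘(ℝ, E) 𝓘(ℝ, F) p φ) (extChartAt 𝓘(ℝ, E) p p) a = u := by
  -- A complex functional with l(a) = 1 gives the rank one complex linear map L = l(·)u with L(a) =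
  -- u. The required map is affine with linear part L in the charts at `p` and `x`.
  obtain ⟨l, hl⟩ := SeparatingDual.exists_eq_one (R := ℂ) ha
  let L : E →L[ℂ] F := l.smulRight u
  let y := extChartAt 𝓘(ℝ, E) p p
  let h : E → F := fun z => extChartAt 𝓘(ℝ, F) x x + L (z - y)
  have hy : h y = extChartAt 𝓘(ℝ, F) x x := by simp [h]
  have hd : Differentiable ℂ h := by fun_prop
  have hsm : ContDiff ℝ ∞ h :=
    contDiff_const.add ((L.restrictScalars ℝ).contDiff.comp (contDiff_id.sub contDiff_const))
  let φ : N → X := fun q => (extChartAt 𝓘(ℝ, F) x).symm (h (extChartAt 𝓘(ℝ, E) p q))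
  let U : Set N := (extChartAt 𝓘(ℝ, E) p).source ∩
    (fun q => h (extChartAt 𝓘(ℝ, E) p q)) ⁻¹' (extChartAt 𝓘(ℝ, F) x).target
  have hφp : φ p = x := by
    change (extChartAt 𝓘(ℝ, F) x).symm (h y) = x
    rw [hy, extChartAt_to_inv]
  refine ⟨U, φ, ?_, ⟨mem_extChartAt_source p, ?_⟩, ⟨?_, ?_⟩, hφp, ?_⟩
  · exact (hsm.continuous.comp_continuousOn (continuousOn_extChartAt p)).isOpen_inter_preimage
      (isOpen_extChartAt_source p) (isOpen_extChartAt_target x)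
  · change h y ∈ (extChartAt 𝓘(ℝ, F) x).target
    rw [hy]
    exact mem_extChartAt_target x
  · exact (contMDiffOn_extChartAt_symm x).comp
      (hsm.contMDiff.comp_contMDiffOn
        ((contMDiffOn_extChartAt (x := p)).mono fun q hq => by simpa using hq.1)) fun q hq => hq.2
  · intro q hq v
    have d1 : MDifferentiableAt 𝓘(ℂ, E) 𝓘(ℂ, E) (extChartAt 𝓘(ℂ, E) p) q :=
      mdifferentiableAt_extChartAt (by simpa using hq.1)
    have d2 : MDifferentiableAt 𝓘(ℂ, E) 𝓘(ℂ, F) h (extChartAt 𝓘(ℂ, E) p q) :=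
      (hd _).mdifferentiableAt
    have d3 : MDifferentiableAt 𝓘(ℂ, F) 𝓘(ℂ, F) (extChartAt 𝓘(ℂ, F) x).symm
        (h (extChartAt 𝓘(ℂ, E) p q)) := mdifferentiableAt_extChartAt_symm hq.2
    exact (d3.comp q (d2.comp q d1)).mfderiv_complexStructure v
  · have hev : writtenInExtChartAt 𝓘(ℝ, E) 𝓘(ℝ, F) p φ =ᶠ[𝓝 y] h := by
      have hcont : ContinuousAt h y := hsm.continuous.continuousAt
      have hx : (extChartAt 𝓘(ℝ, F) x).target ∈ 𝓝 (h y) := by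
        rw [hy]
        exact extChartAt_target_mem_nhds x
      filter_upwards [extChartAt_target_mem_nhds (I := 𝓘(ℝ, E)) p, hcont hx] with z hz hhz
      change extChartAt 𝓘(ℝ, F) (φ p) ((extChartAt 𝓘(ℝ, F) x).symm
        (h (extChartAt 𝓘(ℝ, E) p ((extChartAt 𝓘(ℝ, E) p).symm z)))) = h z
      rw [hφp, PartialEquiv.right_inv _ hz, PartialEquiv.right_inv _ hhz]
    have hfd : HasFDerivAt h (L.restrictScalars ℝ) y := by
      have h1 : HasFDerivAt (fun z => L (z - y)) (L.restrictScalars ℝ) y :=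
        (L.restrictScalars ℝ).hasFDerivAt.comp y ((hasFDerivAt_id y).sub_const y)
      exact h1.const_add _
    rw [hev.fderiv_eq, hfd.fderiv]
    simp [L, hl]

end LocalExpression

theorem proposition3
    {E : Type*} [NormedAddCommGroup E] [NormedSpace ℂ E] [FiniteDimensional ℂ E] [Nontrivial E]
    {N : Type*} [TopologicalSpace N] [ChartedSpace E N] [IsManifold 𝓘(ℂ, E) ω N] [Nonempty N]
    {F : Type*} [NormedAddCommGroup F] [NormedSpace ℂ F] [FiniteDimensional ℂ F]
    {X : Type*} [TopologicalSpace X] [ChartedSpace F X] [IsManifold 𝓘(ℂ, F) ω X]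
    (gN : HermitianMetric E N) (gX : HermitianMetric F X) :
    ((∀ (U : Set N) (φ : N → X), IsOpen U → IsPMHolomorphicOn E F φ U →
        IsPluriharmonicOn E gX.toSmoothMetric φ U) ↔ gX.IsKahler) ∧
    (∀ (U : Set N) (f : N → ℂ), IsOpen U → IsPMHolomorphicOn E ℂ f U →
        IsPluriharmonicOn E flatMetricComplex f U) := by
  refine ⟨⟨fun h => ?_, fun h U φ hU hφ => ?_⟩, fun U f hU hf => ?_⟩
  · rw [HermitianMetric.isKahler_iff_christoffel]
    intro x
    -- Only diagonal values are needed, so a single vector a ≠ 0 of the source suffices, whatever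
    -- the dimension of `N`; holomorphic test maps are enough.
    refine christoffelType11Vanishes_of_self fun u => ?_
    obtain ⟨p⟩ := ‹Nonempty N›
    obtain ⟨a, ha⟩ := exists_ne (0 : E)
    obtain ⟨U, φ, hU, hp, hφ, rfl, hu⟩ := exists_isHolomorphicMapOn p x ha u
    obtain ⟨ε, hε⟩ := IsPMHolomorphicOn.inChartAt hU (Or.inl hφ) hp
    exact ((h U φ hU (Or.inl hφ)).2 p hp).christoffel_self hε hu
  · exact hφ.isPluriharmonicOn hU (gX.isKahler_iff_christoffel.1 h)
  · refine IsPMHolomorphicOn.isPluriharmonicOn (F := ℂ) (X := ℂ) hU hf fun x u v => ?_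
    rw [christoffel_flatMetricComplex, christoffel_flatMetricComplex, add_zero]
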